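/- Let $N$ players choose actions $x_n\in\mathbb{R}^d$, with joint profile $\mathbf{x}=(x_1,\dots,x_N)\in\mathbb{R}^{Nd}$, and let player $n$ have a continuously differentiable utility $u_n:\mathbb{R}^{Nd}\to\mathbb{R}$. Put $v_n(\mathbf{x})=\nabla_{x_n}u_n(\mathbf{x})$ and $\mathbf{v}=(v_1,\dots,v_N)$. Assume that the game is $\lambda$-co-coercive for some $\lambda>0$, i.e. $$\langle \mathbf{x}'-\mathbf{x},\mathbf{v}(\mathbf{x}')-\mathbf{v}(\mathbf{x})\rangle\le-\lambda\|\mathbf{v}(\mathbf{x}')-\mathbf{v}(\mathbf{x})\|^2\qquad\text{for all }\mathbf{x},\mathbf{x}'\in\mathbb{R}^{Nd},$$ and that its set $\mathcal{X}^*$ of Nash equilibria is non-empty, where $\mathbf{x}^*$ is a Nash equilibrium if $u_n(x_n^*,\mathbf{x}^*_{-n})\ge u_n(x_n,\mathbf{x}^*_{-n})$ for every player $n$ and every $x_n\in\mathbb{R}^d$. Let $\beta_t=(t+T_0)^{-\mathfrak{b}}$ with $\tfrac12<\mathfrak{b}<1$ and $T_0\ge\max\{1,\lambda^{-1/\mathfrak{b}},(2\mathfrak{b})^{1/(1-\mathfrak{b})}\}$.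 Starting from an arbitrary (possibly random) profile $\mathbf{x}_0$, let the players update, for $t=0,1,2,\dots$, $$x_{n,t+1}=x_{n,t}+\beta_t\hat v_{n,t},\qquad \hat v_{n,t}=v_n(\mathbf{x}_t)+M_{n,t+1},$$ where, with $\mathbf{M}_{t}=(M_{1,t},\dots,M_{N,t})$ and $\mathcal{F}_t=\sigma(\mathbf{x}_0,\mathbf{M}_1,\dots,\mathbf{M}_t)$, the noise is a martingale difference sequence: each $\mathbf{M}_{t+1}$ is integrable, $\mathbb{E}[\mathbf{M}_{t+1}\mid\mathcal{F}_t]=0$, and, for some constant $\sigma$, $$\mathbb{E}[\|\mathbf{M}_{t+1}\|^2\mid\mathcal{F}_t]\le\sigma^2(1+\|\mathbf{x}_t\|^2)\quad\text{almost surely, for all }t\ge0.$$ Then $\mathcal{X}^*=\{\mathbf{x}\in\mathbb{R}^{Nd}:\mathbf{v}(\mathbf{x})=0\}$, and almost surely $\mathbf{x}_t$ converges to $\mathcal{X}^*$, i.e. $\lim_{t\to\infty}\inf_{\mathbf{z}\in\mathcal{X}^*}\|\mathbf{x}_t-\mathbf{z}\|=0$ almost surely. -/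

import Mathlib

open MeasureTheory Filter Topology
open scoped ENNReal

/-- Action profiles `(x_1, …, x_N)` with `x_n ∈ ℝ^d`. The `ℓ²` product of Euclidean spaces carries
the Euclidean norm and inner product of `ℝ^{Nd}`. -/
abbrev Profile (N d : ℕ) : Type := PiLp 2 (fun _ : Fin N => EuclideanSpace ℝ (Fin d))

/-- A continuous game with `N` players, each of whom chooses an action in `ℝ^d`. -/
structure ContinuousGame (N d : ℕ) where
  /-- `utility n` is the utility function of player `n`. -/
  utility : Fin N → Profile N d → ℝ

namespace ContinuousGame

variable {N d : ℕ}

/-- The profile `(y, x_{-n})`: player `n` plays `y`, all others play as in `x`. -/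
def deviate (x : Profile N d) (n : Fin N) (y : EuclideanSpace ℝ (Fin d)) : Profile N d :=
  WithLp.toLp 2 (Function.update (WithLp.ofLp x) n y)

/-- The game gradient operator `v = (v_1, …, v_N)`, where `v_n = ∇_{x_n} u_n` is the gradient of
the `n`-th utility in the action of player `n`. -/
noncomputable def v (G : ContinuousGame N d) (x : Profile N d) : Profile N d :=
  WithLp.toLp 2 fun n => gradient (fun y => G.utility n (deviate x n y)) (x n)

/-- A `lam`-co-coercive game: continuously differentiable utilities, and `-v` is
`lam`-co-coercive. -/
structure IsCocoercive (G : ContinuousGame N d) (lam : ℝ) : Prop where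
  contDiff : ∀ n, ContDiff ℝ 1 (G.utility n)
  inner_le : ∀ x x' : Profile N d,
    inner ℝ (x' - x) (G.v x' - G.v x) ≤ -lam * ‖G.v x' - G.v x‖ ^ 2

/-- The set of Nash equilibria. -/
def nashSet (G : ContinuousGame N d) : Set (Profile N d) :=
  {x | ∀ (n : Fin N) (y : EuclideanSpace ℝ (Fin d)),
    G.utility n (deviate x n y) ≤ G.utility n x}

end ContinuousGame

/-- The `σ`-algebra `F_t = σ(x_0, M_1, …, M_t)`. -/
abbrev history {Ω E : Type*} [MeasurableSpace E] (x₀ : Ω → E) (M : ℕ → Ω → E) (t : ℕ) :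
    MeasurableSpace Ω :=
  MeasurableSpace.comap x₀ inferInstance ⊔
    ⨆ k ∈ Finset.Icc 1 t, MeasurableSpace.comap (M k) inferInstance

theorem history_le {Ω E : Type*} [MeasurableSpace E] [mΩ : MeasurableSpace Ω] {x₀ : Ω → E}
    {M : ℕ → Ω → E} (h₀ : Measurable x₀) (hM : ∀ t, Measurable (M (t + 1))) (t : ℕ) :
    history x₀ M t ≤ mΩ := by
  refine sup_le h₀.comap_le (iSup₂_le fun k hk => ?_)
  obtain ⟨j, rfl⟩ := Nat.exists_eq_add_of_le' (Finset.mem_Icc.1 hk).1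
  exact (hM j).comap_le

/-- The noise `M_1, M_2, …` is a martingale difference sequence with respect to
`F_t = σ(x_0, M_1, …, M_t)`, and `E[‖M_{t+1}‖² | F_t] ≤ σ² (1 + ‖x_t‖²)` almost surely. The
conditional second moment is the `[0, ∞]`-valued one, so that its finiteness is part of the
bound. -/
structure IsAffineMartingaleNoise {Ω E : Type*} [MeasurableSpace Ω] [NormedAddCommGroup E]
    [NormedSpace ℝ E] [CompleteSpace E] [MeasurableSpace E] (P : Measure Ω) (σ : ℝ)
    (x M : ℕ → Ω → E) : Prop where
  measurable : ∀ t, Measurable (M (t + 1))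
  integrable : ∀ t, Integrable (M (t + 1)) P
  condExp_eq_zero : ∀ t, P[M (t + 1) | history (x 0) M t] =ᵐ[P] 0
  condLExp_le : ∀ t, P⁻[fun ω => ‖M (t + 1) ω‖ₑ ^ 2 | history (x 0) M t]
    ≤ᵐ[P] fun ω => ENNReal.ofReal (σ ^ 2 * (1 + ‖x t ω‖ ^ 2))

/-!
# Almost sure convergence of stochastic gradient play in co-coercive games

**Equilibria.** Co-coercivity of `-v` contains monotonicity, so along a unilateral deviation from a
zero of `v` the deviating player's utility is nonincreasing. First-order stationarity is therefore
not only necessary but sufficient for a Nash equilibrium (`ContinuousGame.IsCocoercive.nashSet_eq`).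

**Convergence.** Fix a zero `z` of `v`. For step sizes `β_t ≤ lam`, co-coercivity gives
`‖x - z + β v(x)‖² ≤ ‖x - z‖² - lam β ‖v(x)‖²` (`norm_step_sq_le`). The noise is conditionally
centred, so on average it only adds `β_t² E[‖M_{t+1}‖² | F_t]`, which is at most a summable multiple
of `1 + ‖x_t - z‖²`. Hence `1 + ‖x_t - z‖²` is an almost supermartingale, and the Robbins–Siegmund
theorem (`ae_tendsto_and_summable_of_condExp_le`) shows that almost surely `‖x_t - z‖` converges
and `∑ β_t ‖v(x_t)‖² < ∞`. No moments of `x_0` are assumed; multiplying everything by the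
`F_0`-measurable weight `(1 + ‖x_0‖²)⁻¹` restores integrability without affecting pathwise
convergence (`ae_tendsto_norm_sub_and_summable`).

Almost surely this holds for all `z` in a countable dense set of zeros. As `∑ β_t = ∞`, some
subsequence has `v(x_t) → 0`; it is bounded, so it clusters at a zero `p` of `v`. Since the
distance to zeros arbitrarily close to `p` converges, `‖x_t - p‖ → 0`
(`exists_tendsto_zero_of_dense`). Thus the iterates even converge to a single, random equilibrium.
-/

/-! ### Nash equilibria of a co-coercive game -/

namespace ContinuousGame

variable {N d : ℕ}

lemma deviate_self (x : Profile N d) (n : Fin N) : deviate x n (x n) = x := by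
  simp [deviate]

lemma deviate_sub (x : Profile N d) (n : Fin N) (y : EuclideanSpace ℝ (Fin d)) :
    deviate x n y - x = WithLp.toLp 2 (Pi.single n (y - x n)) := by
  ext i j
  rcases eq_or_ne i n with rfl | h <;> simp [deviate, *]

lemma deviate_deviate (x : Profile N d) (n : Fin N) (y z : EuclideanSpace ℝ (Fin d)) :
    deviate (deviate x n y) n z = deviate x n z := by
  simp [deviate]

lemma deviate_apply_self (x : Profile N d) (n : Fin N) (y : EuclideanSpace ℝ (Fin d)) :
    deviate x n y n = y := by
  simp [deviate]

lemma differentiable_deviate (x : Profile N d) (n : Fin N) : Differentiable ℝ (deviate x n) := by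
  have h : deviate x n = fun y =>
      x + (PiLp.continuousLinearEquiv 2 ℝ (fun _ : Fin N => EuclideanSpace ℝ (Fin d))).symm
        (ContinuousLinearMap.single ℝ (fun _ : Fin N => EuclideanSpace ℝ (Fin d)) n (y - x n)) := by
    funext y
    rw [← sub_eq_iff_eq_add', deviate_sub]
    rfl
  rw [h]
  fun_prop

variable {G : ContinuousGame N d} {lam : ℝ}

lemma IsCocoercive.hasGradientAt (hG : G.IsCocoercive lam) (x : Profile N d) (n : Fin N)
    (y : EuclideanSpace ℝ (Fin d)) :
    HasGradientAt (fun y => G.utility n (deviate x n y)) (G.v (deviate x n y) n) y := by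
  have h : DifferentiableAt ℝ (fun y => G.utility n (deviate x n y)) y :=
    ((hG.contDiff n).differentiable one_ne_zero).comp (differentiable_deviate x n) y
  simpa [v, deviate_deviate, deviate_apply_self] using h.hasGradientAt

/-- Co-coercivity makes `-v_n` monotone along unilateral deviations of player `n`, so each utility
is concave in the player's own action and the first-order condition is sufficient. -/
theorem IsCocoercive.nashSet_eq (hG : G.IsCocoercive lam) (hlam : 0 ≤ lam) :
    G.nashSet = {z | G.v z = 0} := by
  ext z
  refine ⟨fun hz => ?_, fun hz n y => ?_⟩
  · have h : ∀ n, G.v z n = 0 := by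
      intro n
      have hg := hG.hasGradientAt z n (z n)
      rw [deviate_self] at hg
      have hmax : IsLocalMax (fun y => G.utility n (deviate z n y)) (z n) :=
        Eventually.of_forall fun y => by simpa [deviate_self] using hz n y
      simpa using hmax.hasFDerivAt_eq_zero hg.hasFDerivAt
    exact PiLp.ext fun n => by simpa using h n
  · have hz : G.v z = 0 := hz
    set w : ℝ → EuclideanSpace ℝ (Fin d) := fun s => z n + s • (y - z n) with hw
    have hderiv : ∀ s, HasDerivAt (fun s => G.utility n (deviate z n (w s)))
        (inner ℝ (G.v (deviate z n (w s)) n) (y - z n)) s := by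
      intro s
      have hws : HasDerivAt w (y - z n) s := by
        simpa [hw] using ((hasDerivAt_id s).smul_const (y - z n)).const_add (z n)
      simpa [Function.comp_def] using
        (hG.hasGradientAt z n (w s)).hasFDerivAt.comp_hasDerivAt s hws
    have hneg : ∀ s, 0 < s → inner ℝ (G.v (deviate z n (w s)) n) (y - z n) ≤ 0 := by
      intro s hs
      have h := hG.inner_le z (deviate z n (w s))
      have h2 : inner ℝ (deviate z n (w s) - z) (G.v (deviate z n (w s)) - G.v z)
          = s * inner ℝ (G.v (deviate z n (w s)) n) (y - z n) := by
        rw [deviate_sub, hz, sub_zero, PiLp.inner_apply, Finset.sum_eq_single n]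
        · simp [hw, inner_smul_left, real_inner_comm]
        · intro i _ hi
          simp [hi]
        · simp
      rw [h2] at h
      have h3 : 0 ≤ lam * ‖G.v (deviate z n (w s)) - G.v z‖ ^ 2 := by positivity
      by_contra! h4
      nlinarith [mul_pos hs h4]
    have hanti : AntitoneOn (fun s => G.utility n (deviate z n (w s))) (Set.Icc (0 : ℝ) 1) := by
      refine antitoneOn_of_deriv_nonpos (convex_Icc 0 1)
        (fun s _ => (hderiv s).continuousAt.continuousWithinAt)
        (fun s _ => (hderiv s).differentiableAt.differentiableWithinAt) fun s hs => ?_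
      rw [interior_Icc] at hs
      rw [(hderiv s).deriv]
      exact hneg s hs.1
    simpa [hw, deviate_self] using hanti (Set.left_mem_Icc.2 zero_le_one)
      (Set.right_mem_Icc.2 zero_le_one) zero_le_one

end ContinuousGame

/-! ### Co-coercive operators and convergence of a single trajectory -/

section Deterministic

variable {E : Type*} [NormedAddCommGroup E] [InnerProductSpace ℝ E] {v : E → E} {lam : ℝ}

lemma continuous_of_cocoercive (hlam : 0 < lam)
    (hv : ∀ x x', inner ℝ (x' - x) (v x' - v x) ≤ -lam * ‖v x' - v x‖ ^ 2) : Continuous v := by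
  refine (LipschitzWith.of_dist_le_mul (K := lam⁻¹.toNNReal) fun x' x => ?_).continuous
  rw [dist_eq_norm, dist_eq_norm, Real.coe_toNNReal _ (by positivity)]
  have h1 := hv x x'
  have h2 := (abs_le.1 (abs_real_inner_le_norm (x' - x) (v x' - v x))).1
  rcases eq_or_lt_of_le (norm_nonneg (v x' - v x)) with h0 | h0
  · rw [← h0]; positivity
  · rw [inv_mul_eq_div, le_div_iff₀ hlam]
    by_contra! h
    nlinarith [mul_pos h0 (sub_pos.2 h)]

/-- A gradient step of length `β ≤ lam` is a contraction towards any zero of `v`, with a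
quantitative gain. -/
lemma norm_step_sq_le {z x : E} {β : ℝ} (hβ : 0 ≤ β) (hβlam : β ≤ lam) (hz : v z = 0)
    (hv : ∀ x x', inner ℝ (x' - x) (v x' - v x) ≤ -lam * ‖v x' - v x‖ ^ 2) :
    ‖x - z + β • v x‖ ^ 2 ≤ ‖x - z‖ ^ 2 - lam * (β * ‖v x‖ ^ 2) := by
  have h := hv z x
  rw [hz, sub_zero] at h
  rw [norm_add_sq_real, inner_smul_right, norm_smul, mul_pow, Real.norm_eq_abs, sq_abs]
  have h1 := mul_le_mul_of_nonneg_left h hβ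
  have h2 : β * β * ‖v x‖ ^ 2 ≤ β * lam * ‖v x‖ ^ 2 := by gcongr
  nlinarith

/-- The pathwise (Opial-type) argument: divergence of `∑ β_t` makes `v (x_t)` vanish along a
subsequence, which clusters at a zero `p` of `v`; the distance to `p` converges, hence tends to
`0`. It is enough to know convergence of the distances to a dense set of zeros. -/
theorem exists_tendsto_zero_of_dense {E : Type*} [NormedAddCommGroup E] [ProperSpace E] {v : E → E}
    (hv : Continuous v) {D : Set E}
    (hDd : {z | v z = 0} ⊆ closure D) (hne : D.Nonempty)
    {β : ℕ → ℝ} (hβ : ∀ t, 0 ≤ β t) (hdiv : ¬ Summable β) {x : ℕ → E}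
    (hconv : ∀ z ∈ D, ∃ c, Tendsto (fun t => ‖x t - z‖) atTop (𝓝 c))
    (hsum : Summable fun t => β t * ‖v (x t)‖ ^ 2) :
    ∃ p, v p = 0 ∧ Tendsto x atTop (𝓝 p) := by
  have hfreq : ∀ k : ℕ, ∃ᶠ t in atTop, ‖v (x t)‖ ^ 2 < 1 / ((k : ℝ) + 1) := by
    intro k hk
    refine hdiv (Summable.of_norm_bounded_eventually_nat (hsum.mul_left ((k : ℝ) + 1)) ?_)
    filter_upwards [hk] with t ht
    rw [not_lt, div_le_iff₀ (by positivity)] at ht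
    rw [Real.norm_of_nonneg (hβ t)]
    nlinarith [mul_le_mul_of_nonneg_left ht (hβ t)]
  obtain ⟨φ, hφ, hφv⟩ := extraction_forall_of_frequently hfreq
  obtain ⟨z₀, hz₀⟩ := hne
  obtain ⟨c₀, hc₀⟩ := hconv z₀ hz₀
  obtain ⟨R, hR⟩ := hc₀.bddAbove_range
  have hball : ∀ k, x (φ k) ∈ Metric.closedBall z₀ R := fun k => by
    rw [Metric.mem_closedBall, dist_eq_norm]
    exact hR ⟨φ k, rfl⟩
  obtain ⟨p, -, ψ, hψ, hp⟩ := tendsto_subseq_of_bounded Metric.isBounded_closedBall hball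
  have hvp : v p = 0 := by
    have h1 : Tendsto (fun k => ‖v (x (φ (ψ k)))‖ ^ 2) atTop (𝓝 (‖v p‖ ^ 2)) :=
      ((hv.norm.pow 2).tendsto p).comp hp
    have h2 : Tendsto (fun k => ‖v (x (φ (ψ k)))‖ ^ 2) atTop (𝓝 0) :=
      squeeze_zero (fun _ => by positivity) (fun k => (hφv (ψ k)).le)
        (tendsto_one_div_add_atTop_nhds_zero_nat.comp hψ.tendsto_atTop)
    simpa using tendsto_nhds_unique h1 h2
  refine ⟨p, hvp, Metric.tendsto_atTop.2 fun ε hε => ?_⟩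
  obtain ⟨z, hzD, hz⟩ := Metric.mem_closure_iff.1 (hDd hvp) (ε / 4) (by positivity)
  rw [dist_eq_norm] at hz
  obtain ⟨c, hc⟩ := hconv z hzD
  have hcε : c ≤ ε / 4 := by
    have h1 : Tendsto (fun k => ‖x (φ (ψ k)) - z‖) atTop (𝓝 ‖p - z‖) := (hp.sub_const z).norm
    have h2 := hc.comp (hφ.comp hψ).tendsto_atTop
    rw [tendsto_nhds_unique h2 h1]
    exact hz.le
  obtain ⟨T, hT⟩ := eventually_atTop.1 (hc.eventually_lt_const (by linarith : c < ε / 2))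
  refine ⟨T, fun t ht => ?_⟩
  rw [dist_eq_norm]
  have h1 := hT t ht
  have h2 := norm_sub_le_norm_sub_add_norm_sub (x t) z p
  rw [norm_sub_rev z p] at h2
  linarith

end Deterministic

/-! ### Step sizes -/

section StepSize

variable {b T₀ : ℝ} {β : ℕ → ℝ}

lemma not_summable_stepsize (hb : b ≤ 1) (hT₀ : 0 ≤ T₀)
    (hβ : ∀ t : ℕ, β t = 1 / ((t : ℝ) + T₀) ^ b) : ¬ Summable β := by
  intro h
  refine absurd ((Real.summable_one_div_nat_add_rpow T₀ b).1 (h.congr fun t => ?_)) (not_lt.2 hb)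
  rw [hβ, abs_of_nonneg (by positivity)]

lemma summable_stepsize_sq (hb : 1 / 2 < b) (hT₀ : 0 ≤ T₀)
    (hβ : ∀ t : ℕ, β t = 1 / ((t : ℝ) + T₀) ^ b) : Summable fun t => β t ^ 2 := by
  refine ((Real.summable_one_div_nat_add_rpow T₀ (b * 2)).2 (by linarith)).congr fun t => ?_
  rw [hβ, abs_of_nonneg (by positivity), div_pow, one_pow, ← Real.rpow_natCast,
    ← Real.rpow_mul (by positivity), Nat.cast_ofNat]

lemma stepsize_le {lam : ℝ} (hlam : 0 < lam) (hb : 0 < b) (hT₀ : lam ^ (-1 / b) ≤ T₀)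
    (hβ : ∀ t : ℕ, β t = 1 / ((t : ℝ) + T₀) ^ b) (t : ℕ) : β t ≤ lam := by
  have h0 : 0 < lam ^ (-1 / b) := Real.rpow_pos_of_pos hlam _
  have h : lam⁻¹ ≤ ((t : ℝ) + T₀) ^ b := by
    calc lam⁻¹ = (lam ^ (-1 / b)) ^ b := by
          rw [← Real.rpow_mul hlam.le, div_mul_cancel₀ _ hb.ne', Real.rpow_neg_one]
      _ ≤ ((t : ℝ) + T₀) ^ b := by
          refine Real.rpow_le_rpow h0.le ?_ hb.le
          linarith [(Nat.cast_nonneg t : (0 : ℝ) ≤ t)]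
  rw [hβ, one_div]
  exact inv_le_of_inv_le₀ hlam h

end StepSize

/-! ### Conditional expectations -/

section CondExp

variable {Ω : Type*} {m mΩ : MeasurableSpace Ω} {P : Measure Ω}

/-- Pull-out property of the `[0, ∞]`-valued conditional expectation: `g` and `P⁻[g | m]` are
densities of measures that agree on `m`. -/
theorem condLExp_mul_left_of_measurable (hm : m ≤ mΩ) [SigmaFinite (P.trim hm)]
    {f g : Ω → ℝ≥0∞} (hf : Measurable[m] f) (hg : Measurable g) :
    P⁻[f * g | m] =ᵐ[P] f * P⁻[g | m] := by
  symm
  refine ae_eq_condLExp hm P _ (hf.mul (measurable_condLExp m P g)) fun s hs => ?_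
  have htrim : (P.withDensity P⁻[g | m]).trim hm = (P.withDensity g).trim hm := by
    refine @Measure.ext _ m _ _ fun s hs => ?_
    rw [trim_measurableSet_eq hm hs, trim_measurableSet_eq hm hs, withDensity_apply _ (hm s hs),
      withDensity_apply _ (hm s hs), setLIntegral_condLExp hm P g hs]
  have key : ∀ k : Ω → ℝ≥0∞, Measurable k →
      ∫⁻ ω in s, (f * k) ω ∂P = ∫⁻ ω, s.indicator f ω ∂(P.withDensity k).trim hm := by
    intro k hk
    rw [lintegral_trim hm (hf.indicator hs),
      lintegral_withDensity_eq_lintegral_mul P hk ((hf.indicator hs).mono hm le_rfl),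
      ← lintegral_indicator (hm s hs)]
    congr 1 with ω
    by_cases hω : ω ∈ s <;> simp [hω, mul_comm]
  rw [key _ (measurable_condLExp' m P g), key _ hg, htrim]

variable {E : Type*} [NormedAddCommGroup E] [MeasurableSpace E] [BorelSpace E]

/-- A weighted conditional second moment is integrable and has the expected bound, without
integrability of `‖M‖ ^ 2` itself. -/
lemma weighted_sq_condExp_le [IsFiniteMeasure P] (hm : m ≤ mΩ) {M : Ω → E} (hM : Measurable M)
    {w h : Ω → ℝ} (hw : Measurable[m] w) (hw0 : 0 ≤ w) (h0 : 0 ≤ h)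
    (hM2 : P⁻[fun ω => ‖M ω‖ₑ ^ 2 | m] ≤ᵐ[P] fun ω => ENNReal.ofReal (h ω))
    (hwh : Integrable (fun ω => w ω * h ω) P) :
    Integrable (fun ω => w ω * ‖M ω‖ ^ 2) P ∧
      P[fun ω => w ω * ‖M ω‖ ^ 2 | m] ≤ᵐ[P] fun ω => w ω * h ω := by
  set f : Ω → ℝ≥0∞ := (fun ω => ENNReal.ofReal (w ω)) * fun ω => ‖M ω‖ₑ ^ 2 with hf
  have hfreal : ∀ ω, (f ω).toReal = w ω * ‖M ω‖ ^ 2 := fun ω => by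
    simp [hf, ENNReal.toReal_ofReal (hw0 ω)]
  have hfm : Measurable f :=
    ((hw.mono hm le_rfl).ennreal_ofReal).mul (hM.enorm.pow_const 2)
  have hle : P⁻[f | m] ≤ᵐ[P] fun ω => ENNReal.ofReal (w ω * h ω) := by
    filter_upwards [condLExp_mul_left_of_measurable (P := P) hm hw.ennreal_ofReal
      (hM.enorm.pow_const 2), hM2] with ω h1 h2
    rw [h1, ENNReal.ofReal_mul (hw0 ω)]
    exact mul_le_mul_right h2 _
  have hfin : ∫⁻ ω, f ω ∂P ≠ ∞ := by
    rw [← lintegral_condLExp hm P f]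
    refine ((lintegral_mono_ae hle).trans_lt ?_).ne
    rw [← ofReal_integral_eq_lintegral_ofReal hwh
      (Eventually.of_forall fun ω => mul_nonneg (hw0 ω) (h0 ω))]
    exact ENNReal.ofReal_lt_top
  have hint : Integrable (fun ω => (f ω).toReal) P :=
    integrable_toReal_of_lintegral_ne_top hfm.aemeasurable hfin
  simp_rw [← hfreal]
  refine ⟨hint, ?_⟩
  filter_upwards [toReal_condLExp m hfm.aemeasurable hfin, hle] with ω h1 h2
  rw [← h1]
  exact ENNReal.toReal_le_of_le_ofReal (mul_nonneg (hw0 ω) (h0 ω)) h2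

/-- One step `y + β M` of a recursion driven by conditionally centred noise: the cross term
averages out, so the (weighted) mean square grows by the conditional second moment only. -/
lemma condExp_weighted_norm_add_sq_le [InnerProductSpace ℝ E] [CompleteSpace E]
    [SecondCountableTopology E] [IsFiniteMeasure P] (hm : m ≤ mΩ) {M y : Ω → E}
    (hM : Measurable M) (hMint : Integrable M P) (hM0 : P[M | m] =ᵐ[P] 0)
    {w h : Ω → ℝ} (hw : Measurable[m] w) (hw0 : 0 ≤ w) (h0 : 0 ≤ h)
    (hM2 : P⁻[fun ω => ‖M ω‖ₑ ^ 2 | m] ≤ᵐ[P] fun ω => ENNReal.ofReal (h ω))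
    (hwh : Integrable (fun ω => w ω * h ω) P)
    (hy : Measurable[m] y) (hwy : Integrable (fun ω => w ω * ‖y ω‖ ^ 2) P) (β : ℝ) :
    Integrable (fun ω => w ω * ‖y ω + β • M ω‖ ^ 2) P ∧
      P[fun ω => w ω * ‖y ω + β • M ω‖ ^ 2 | m] ≤ᵐ[P]
        fun ω => w ω * ‖y ω‖ ^ 2 + β ^ 2 * (w ω * h ω) := by
  obtain ⟨hI, hI2⟩ := weighted_sq_condExp_le hm hM hw hw0 h0 hM2 hwh
  have hYm : StronglyMeasurable[m] fun ω => (2 * β * w ω) • y ω :=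
    ((hw.const_mul (2 * β)).smul hy).stronglyMeasurable
  have hcross : Integrable (fun ω => innerSL ℝ ((2 * β * w ω) • y ω) (M ω)) P := by
    refine Integrable.mono' ((hwy.add hI).const_mul |β|) ?_ (Eventually.of_forall fun ω => ?_)
    · exact (hYm.mono hm).aestronglyMeasurable.inner (𝕜 := ℝ) hM.aestronglyMeasurable
    · simp only [innerSL_apply_apply, inner_smul_left, Pi.add_apply, RCLike.conj_to_real, norm_mul,
        Real.norm_eq_abs, abs_of_nonneg (hw0 ω), abs_two]
      have h1 := abs_real_inner_le_norm (y ω) (M ω)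
      have h2 : 2 * |inner ℝ (y ω) (M ω)| ≤ ‖y ω‖ ^ 2 + ‖M ω‖ ^ 2 := by
        nlinarith [sq_nonneg (‖y ω‖ - ‖M ω‖)]
      have h3 := mul_le_mul_of_nonneg_left h2 (mul_nonneg (abs_nonneg β) (hw0 ω))
      linarith
  have hcross0 : P[fun ω => innerSL ℝ ((2 * β * w ω) • y ω) (M ω) | m] =ᵐ[P] 0 := by
    filter_upwards [condExp_bilin_of_stronglyMeasurable_left (innerSL ℝ) hYm hcross hMint, hM0]
      with ω h1 h2
    rw [h1, h2]
    exact map_zero _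
  have hexp : (fun ω => w ω * ‖y ω + β • M ω‖ ^ 2) =
      (fun ω => w ω * ‖y ω‖ ^ 2) + ((fun ω => innerSL ℝ ((2 * β * w ω) • y ω) (M ω)) +
        (β ^ 2) • fun ω => w ω * ‖M ω‖ ^ 2) := by
    funext ω
    simp only [Pi.add_apply, Pi.smul_apply, smul_eq_mul, innerSL_apply_apply, inner_smul_left,
      RCLike.conj_to_real, norm_add_sq_real, inner_smul_right, norm_smul, mul_pow,
      Real.norm_eq_abs, sq_abs]
    ring
  have hwym : StronglyMeasurable[m] fun ω => w ω * ‖y ω‖ ^ 2 :=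
    (hw.mul ((measurable_norm.comp hy).pow_const 2)).stronglyMeasurable
  have hI' : Integrable ((β ^ 2) • fun ω => w ω * ‖M ω‖ ^ 2) P := hI.smul (β ^ 2)
  rw [hexp]
  refine ⟨hwy.add (hcross.add hI'), ?_⟩
  filter_upwards [condExp_add hwy (hcross.add hI') m, condExp_add hcross hI' m, hcross0,
    condExp_smul (μ := P) (β ^ 2) (fun ω => w ω * ‖M ω‖ ^ 2) m, hI2] with ω h1 h2 h3 h4 h5
  rw [h1, Pi.add_apply, h2, Pi.add_apply, h3, h4,
    condExp_of_stronglyMeasurable hm hwym hwy, Pi.smul_apply, smul_eq_mul, Pi.zero_apply, zero_add]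
  gcongr

end CondExp

/-! ### Almost supermartingales -/

section RobbinsSiegmund

variable {Ω : Type*} {mΩ : MeasurableSpace Ω} {P : Measure Ω} {ℱ : Filtration ℕ mΩ}

lemma exists_ae_tendsto_of_nonneg_supermartingale [IsFiniteMeasure P] {W : ℕ → Ω → ℝ}
    (hW : Supermartingale W ℱ P) (h0 : ∀ t ω, 0 ≤ W t ω) :
    ∀ᵐ ω ∂P, ∃ c, Tendsto (fun t => W t ω) atTop (𝓝 c) := by
  have hbdd : ∀ t, eLpNorm ((-W) t) 1 P ≤ (∫ ω, W 0 ω ∂P).toNNReal := by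
    intro t
    rw [Pi.neg_apply, eLpNorm_neg, eLpNorm_one_eq_lintegral_enorm,
      ← ofReal_integral_norm_eq_lintegral_enorm (hW.integrable t)]
    refine ENNReal.ofReal_le_ofReal ?_
    simp_rw [Real.norm_of_nonneg (h0 t _)]
    simpa using hW.setIntegral_le (Nat.zero_le t) MeasurableSet.univ
  filter_upwards [hW.neg.exists_ae_tendsto_of_bdd hbdd] with ω ⟨c, hc⟩
  exact ⟨-c, by simpa using hc.neg⟩

/-- The **Robbins–Siegmund theorem** for nonnegative almost supermartingales with deterministic
growth rates `a t`. -/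
theorem ae_tendsto_and_summable_of_condExp_le [IsFiniteMeasure P] {V U : ℕ → Ω → ℝ} {a : ℕ → ℝ}
    (ha0 : ∀ t, 0 ≤ a t) (ha : Summable a) (hV : StronglyAdapted ℱ V) (hU : StronglyAdapted ℱ U)
    (hV0 : ∀ t ω, 0 ≤ V t ω) (hU0 : ∀ t ω, 0 ≤ U t ω) (hVi : ∀ t, Integrable (V t) P)
    (hUi : ∀ t, Integrable (U t) P)
    (hle : ∀ t, P[V (t + 1) | ℱ t] ≤ᵐ[P] fun ω => (1 + a t) * V t ω - U t ω) :
    ∀ᵐ ω ∂P, (∃ c, Tendsto (fun t => V t ω) atTop (𝓝 c)) ∧ Summable fun t => U t ω := by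
  set Q : ℕ → ℝ := fun t => ∏ s ∈ Finset.range t, (1 + a s) with hQ
  have hQ1 : ∀ t, 1 ≤ Q t := fun t =>
    Finset.one_le_prod fun s _ => by linarith [ha0 s]
  have hQpos : ∀ t, 0 < Q t := fun t => one_pos.trans_le (hQ1 t)
  have hQs : ∀ t, Q (t + 1) = Q t * (1 + a t) := fun t => Finset.prod_range_succ _ _
  obtain ⟨q, hq⟩ : ∃ q, Tendsto Q atTop (𝓝 q) :=
    ⟨_, (Real.multipliable_one_add_of_summable ha).hasProd.tendsto_prod_nat⟩
  obtain ⟨B, hB⟩ := hq.bddAbove_range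
  set S : ℕ → Ω → ℝ := fun t => ∑ s ∈ Finset.range t, (Q (s + 1))⁻¹ • U s with hS
  have hSadp : ∀ t, StronglyMeasurable[ℱ t] (S (t + 1)) := fun t =>
    Finset.stronglyMeasurable_sum _ fun s hs =>
      ((hU s).mono (ℱ.mono (Nat.lt_succ_iff.1 (Finset.mem_range.1 hs)))).const_smul _
  have hSi : ∀ t, Integrable (S t) P := fun t =>
    integrable_finsetSum' _ fun s _ => (hUi s).smul _
  have hS0 : ∀ t ω, 0 ≤ S t ω := fun t ω => by
    simp only [hS, Finset.sum_apply, Pi.smul_apply, smul_eq_mul]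
    exact Finset.sum_nonneg fun s _ => mul_nonneg (inv_nonneg.2 (hQpos _).le) (hU0 s ω)
  -- Discounting `V` by `Q` and adding back the discounted losses gives a supermartingale.
  have hW : Supermartingale (fun t => (Q t)⁻¹ • V t + S t) ℱ P := by
    refine supermartingale_nat (fun t => ?_) (fun t => ((hVi t).smul _).add (hSi t)) fun t => ?_
    · refine ((hV t).const_smul _).add ?_
      cases t with
      | zero => simpa [hS] using stronglyMeasurable_zero
      | succ t => exact (hSadp t).mono (ℱ.mono t.le_succ)
    · filter_upwards [condExp_add ((hVi (t + 1)).smul (Q (t + 1))⁻¹) (hSi (t + 1)) (ℱ t),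
        condExp_smul (μ := P) (Q (t + 1))⁻¹ (V (t + 1)) (ℱ t), hle t] with ω h1 h2 h3
      rw [h1, Pi.add_apply, h2, condExp_of_stronglyMeasurable (ℱ.le t) (hSadp t) (hSi (t + 1))]
      simp only [Pi.add_apply, Pi.smul_apply, smul_eq_mul, hS, Finset.sum_range_succ]
      have h4 := mul_le_mul_of_nonneg_left h3 (inv_nonneg.2 (hQpos (t + 1)).le)
      have h5 : (Q (t + 1))⁻¹ * ((1 + a t) * V t ω - U t ω)
          = (Q t)⁻¹ * V t ω - (Q (t + 1))⁻¹ * U t ω := by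
        have := hQpos t
        have : 0 < 1 + a t := by linarith [ha0 t]
        rw [hQs]
        field_simp
      rw [h5, le_sub_iff_add_le] at h4
      rw [← add_assoc, add_right_comm]
      exact add_le_add_left h4 _
  have hVQ0 : ∀ t ω, 0 ≤ (Q t)⁻¹ * V t ω := fun t ω =>
    mul_nonneg (inv_nonneg.2 (hQpos t).le) (hV0 t ω)
  filter_upwards [exists_ae_tendsto_of_nonneg_supermartingale hW fun t ω =>
    add_nonneg (hVQ0 t ω) (hS0 t ω)] with ω ⟨c, hc⟩
  have hSω : ∀ t, S t ω = ∑ s ∈ Finset.range t, (Q (s + 1))⁻¹ * U s ω := fun t => by simp [hS]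
  simp only [Pi.add_apply, Pi.smul_apply, smul_eq_mul, hSω] at hc
  have hUQ0 : ∀ s, 0 ≤ (Q (s + 1))⁻¹ * U s ω := fun s =>
    mul_nonneg (inv_nonneg.2 (hQpos _).le) (hU0 s ω)
  obtain ⟨C, hC⟩ := hc.bddAbove_range
  have hsum : Summable fun s => (Q (s + 1))⁻¹ * U s ω :=
    summable_of_sum_range_le hUQ0 fun t =>
      (le_add_of_nonneg_left (hVQ0 t ω)).trans (hC ⟨t, rfl⟩)
  constructor
  · refine ⟨(c - ∑' s, (Q (s + 1))⁻¹ * U s ω) * q, ?_⟩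
    refine ((hc.sub hsum.hasSum.tendsto_sum_nat).mul hq).congr fun t => ?_
    have := (hQpos t).ne'
    field_simp
    ring
  · refine Summable.of_nonneg_of_le (fun t => hU0 t ω) (fun t => ?_) (hsum.mul_left B)
    have h1 : Q (t + 1) ≤ B := hB ⟨t + 1, rfl⟩
    calc U t ω = Q (t + 1) * ((Q (t + 1))⁻¹ * U t ω) := by
          rw [mul_inv_cancel_left₀ (hQpos _).ne']
      _ ≤ B * ((Q (t + 1))⁻¹ * U t ω) := mul_le_mul_of_nonneg_right h1 (hUQ0 t)

end RobbinsSiegmund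

/-! ### Stochastic approximation of zeros of a co-coercive operator -/

/-- The filtration `F_t = σ(x_0, M_1, …, M_t)`. -/
def historyFiltration {Ω E : Type*} [MeasurableSpace E] [mΩ : MeasurableSpace Ω] {x₀ : Ω → E}
    {M : ℕ → Ω → E} (h₀ : Measurable x₀) (hM : ∀ t, Measurable (M (t + 1))) :
    Filtration ℕ mΩ where
  seq := history x₀ M
  mono' _ _ hst := sup_le_sup_left
    (biSup_mono fun _ hk => Finset.Icc_subset_Icc_right hst hk) _
  le' := history_le h₀ hM

section StochasticApproximation

variable {E : Type*} [NormedAddCommGroup E] [InnerProductSpace ℝ E] [ProperSpace E]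
  [MeasurableSpace E] [BorelSpace E] {v : E → E} {lam : ℝ}
  {Ω : Type*} {β : ℕ → ℝ} {x M : ℕ → Ω → E}

lemma measurable_iterate_history (hv : Continuous v)
    (hx : ∀ t ω, x (t + 1) ω = x t ω + β t • (v (x t ω) + M (t + 1) ω)) (t : ℕ) :
    Measurable[history (x 0) M t] (x t) := by
  induction t with
  | zero => exact (comap_measurable (x 0)).mono le_sup_left le_rfl
  | succ t ih =>
    have hxt : Measurable[history (x 0) M (t + 1)] (x t) := ih.mono
      (sup_le_sup_left (biSup_mono fun _ hk => Finset.Icc_subset_Icc_right t.le_succ hk) _) le_rfl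
    have hMt : Measurable[history (x 0) M (t + 1)] (M (t + 1)) :=
      (comap_measurable (M (t + 1))).mono (le_sup_of_le_right (le_iSup₂_of_le (t + 1)
        (Finset.mem_Icc.2 ⟨Nat.le_add_left 1 t, le_rfl⟩) le_rfl)) le_rfl
    rw [funext (hx t)]
    exact hxt.add (((hv.measurable.comp hxt).add hMt).const_smul (β t))

variable [MeasurableSpace Ω] {P : Measure Ω} {σ : ℝ}

/-- The Lyapunov function `w (1 + ‖x_t - z‖²)`, with the weight `w = (1 + ‖x_0‖²)⁻¹` making it
integrable for an arbitrary initial condition, is an almost supermartingale. -/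
theorem ae_tendsto_norm_sub_and_summable [IsFiniteMeasure P] (hlam : 0 < lam)
    (hv : ∀ x x', inner ℝ (x' - x) (v x' - v x) ≤ -lam * ‖v x' - v x‖ ^ 2)
    (hβ0 : ∀ t, 0 ≤ β t) (hβlam : ∀ t, β t ≤ lam) (hβ2 : Summable fun t => β t ^ 2)
    (hx₀ : Measurable (x 0))
    (hx : ∀ t ω, x (t + 1) ω = x t ω + β t • (v (x t ω) + M (t + 1) ω))
    (hM : IsAffineMartingaleNoise P σ x M) {z : E} (hz : v z = 0) :
    ∀ᵐ ω ∂P, (∃ c, Tendsto (fun t => ‖x t ω - z‖) atTop (𝓝 c)) ∧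
      Summable fun t => β t * ‖v (x t ω)‖ ^ 2 := by
  have hvc := continuous_of_cocoercive hlam hv
  set ℱ := historyFiltration hx₀ hM.measurable
  have hxm : ∀ t, Measurable[ℱ t] (x t) := measurable_iterate_history hvc hx
  set w : Ω → ℝ := fun ω => (1 + ‖x 0 ω‖ ^ 2)⁻¹ with hw
  have hwpos : ∀ ω, 0 < w ω := fun ω => by positivity
  have hw1 : ∀ ω, w ω ≤ 1 := fun ω => inv_le_one_of_one_le₀ (by simp)
  have hwm : ∀ t, Measurable[ℱ t] w := fun t =>
    (((((measurable_norm.comp (hxm 0)).pow_const 2)).const_add 1).inv).mono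
      (ℱ.mono (Nat.zero_le t)) le_rfl
  have hwi : Integrable w P := Integrable.of_bound
    ((hwm 0).mono (ℱ.le 0) le_rfl).aestronglyMeasurable 1
    (Eventually.of_forall fun ω => by rw [Real.norm_of_nonneg (hwpos ω).le]; exact hw1 ω)
  set C : ℝ := 2 * (1 + ‖z‖ ^ 2) with hC
  have hC0 : 0 ≤ C := by positivity
  -- Second moments about `0` and about `z` are comparable.
  have hcmp : ∀ y y' : E, ‖y - y'‖ = ‖z‖ → 1 + ‖y‖ ^ 2 ≤ C * (1 + ‖y'‖ ^ 2) := by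
    intro y y' h
    have h1 : ‖y‖ ≤ ‖z‖ + ‖y'‖ := by
      rw [← h]; simpa using norm_add_le (y - y') y'
    have h2 : ‖y‖ ^ 2 ≤ (‖z‖ + ‖y'‖) ^ 2 := by gcongr
    nlinarith [sq_nonneg (‖z‖ - ‖y'‖), mul_nonneg (sq_nonneg ‖z‖) (sq_nonneg ‖y'‖)]
  set D : ℕ → Ω → ℝ := fun t ω => w ω * ‖x t ω - z‖ ^ 2 with hD
  have hDm : ∀ t, Measurable[ℱ t] (D t) := fun t =>
    (hwm t).mul ((measurable_norm.comp ((hxm t).sub_const z)).pow_const 2)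
  set y : ℕ → Ω → E := fun t ω => x t ω - z + β t • v (x t ω) with hy
  have hym : ∀ t, Measurable[ℱ t] (y t) := fun t =>
    ((hxm t).sub_const z).add ((hvc.measurable.comp (hxm t)).const_smul (β t))
  set U : ℕ → Ω → ℝ := fun t ω => lam * (w ω * (β t * ‖v (x t ω)‖ ^ 2)) with hU
  have hUm : ∀ t, Measurable[ℱ t] (U t) := fun t =>
    ((hwm t).mul (((measurable_norm.comp (hvc.measurable.comp (hxm t))).pow_const 2).const_mul
      (β t))).const_mul lam
  have hU0 : ∀ t ω, 0 ≤ U t ω := fun t ω =>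
    mul_nonneg hlam.le (mul_nonneg (hwpos ω).le (mul_nonneg (hβ0 t) (sq_nonneg _)))
  have hdrop : ∀ t ω, w ω * ‖y t ω‖ ^ 2 ≤ D t ω - U t ω := fun t ω => by
    have h := mul_le_mul_of_nonneg_left
      (norm_step_sq_le (z := z) (x := x t ω) (hβ0 t) (hβlam t) hz hv) (hwpos ω).le
    simp only [hD, hU, hy]
    linarith
  have hwy0 : ∀ t ω, 0 ≤ w ω * ‖y t ω‖ ^ 2 := fun t ω => mul_nonneg (hwpos ω).le (sq_nonneg _)
  set h : ℕ → Ω → ℝ := fun t ω => σ ^ 2 * (1 + ‖x t ω‖ ^ 2) with hh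
  have hh0 : ∀ t, 0 ≤ h t := fun t ω => by simp only [hh, Pi.zero_apply]; positivity
  have hwhle : ∀ t ω, w ω * h t ω ≤ σ ^ 2 * C * (w ω + D t ω) := fun t ω => by
    have h1 := mul_le_mul_of_nonneg_left (hcmp (x t ω) (x t ω - z) (by simp))
      (mul_nonneg (sq_nonneg σ) (hwpos ω).le)
    simp only [hD, hh]
    linarith
  have hyi : ∀ t, Integrable (D t) P → Integrable (fun ω => w ω * ‖y t ω‖ ^ 2) P := by
    intro t hDi
    refine hDi.mono' (((hwm t).mul ((measurable_norm.comp (hym t)).pow_const 2)).mono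
      (ℱ.le t) le_rfl).aestronglyMeasurable (Eventually.of_forall fun ω => ?_)
    rw [Real.norm_of_nonneg (hwy0 t ω)]
    linarith [hdrop t ω, hU0 t ω]
  have hwhi : ∀ t, Integrable (D t) P → Integrable (fun ω => w ω * h t ω) P := by
    intro t hDi
    refine ((hwi.add hDi).const_mul (σ ^ 2 * C)).mono' (((hwm t).mul
      ((((measurable_norm.comp (hxm t)).pow_const 2).const_add 1).const_mul (σ ^ 2))).mono
      (ℱ.le t) le_rfl).aestronglyMeasurable (Eventually.of_forall fun ω => ?_)
    rw [Real.norm_of_nonneg (mul_nonneg (hwpos ω).le (hh0 t ω))]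
    exact hwhle t ω
  have hDsucc : ∀ t, D (t + 1) = fun ω => w ω * ‖y t ω + β t • M (t + 1) ω‖ ^ 2 := fun t => by
    funext ω
    simp only [hD, hy, hx, smul_add]
    congr 3
    abel
  have hstep := fun t (hDi : Integrable (D t) P) =>
    condExp_weighted_norm_add_sq_le (ℱ.le t) (hM.measurable t) (hM.integrable t)
      (hM.condExp_eq_zero t) (hwm t) (fun ω => (hwpos ω).le) (hh0 t) (hM.condLExp_le t)
      (hwhi t hDi) (hym t) (hyi t hDi) (β t)
  have hDi : ∀ t, Integrable (D t) P := by
    intro t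
    induction t with
    | zero =>
      refine Integrable.of_bound ((hDm 0).mono (ℱ.le 0) le_rfl).aestronglyMeasurable C
        (Eventually.of_forall fun ω => ?_)
      rw [Real.norm_of_nonneg (mul_nonneg (hwpos ω).le (sq_nonneg _))]
      simp only [hw]
      rw [inv_mul_le_iff₀ (by positivity)]
      linarith [hcmp (x 0 ω - z) (x 0 ω) (by simp)]
    | succ t ih => rw [hDsucc]; exact (hstep t ih).1
  have hUi : ∀ t, Integrable (U t) P := fun t => by
    refine (hDi t).mono' ((hUm t).mono (ℱ.le t) le_rfl).aestronglyMeasurable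
      (Eventually.of_forall fun ω => ?_)
    rw [Real.norm_of_nonneg (hU0 t ω)]
    linarith [hdrop t ω, hwy0 t ω]
  have hRS := ae_tendsto_and_summable_of_condExp_le (P := P) (ℱ := ℱ) (V := fun t => w + D t)
    (U := U) (a := fun t => σ ^ 2 * C * β t ^ 2) (fun t => by positivity) (hβ2.mul_left _)
    (fun t => ((hwm t).add (hDm t)).stronglyMeasurable) (fun t => (hUm t).stronglyMeasurable)
    (fun t ω => add_nonneg (hwpos ω).le (mul_nonneg (hwpos ω).le (sq_nonneg _))) hU0
    (fun t => hwi.add (hDi t)) hUi fun t => by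
      filter_upwards [condExp_add hwi (hDi (t + 1)) (ℱ t), (hstep t (hDi t)).2] with ω h1 h2
      rw [h1, Pi.add_apply,
        condExp_of_stronglyMeasurable (ℱ.le t) (hwm t).stronglyMeasurable hwi, hDsucc]
      have h3 := mul_le_mul_of_nonneg_left (hwhle t ω) (sq_nonneg (β t))
      have h4 := hdrop t ω
      simp only [Pi.add_apply]
      linarith
  filter_upwards [hRS] with ω ⟨⟨c, hc⟩, hs⟩
  have hw0 := (hwpos ω).ne'
  constructor
  · refine ⟨√((w ω)⁻¹ * (c - w ω)), (((hc.sub_const (w ω)).const_mul (w ω)⁻¹).sqrt).congr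
      fun t => ?_⟩
    simp only [Pi.add_apply, add_sub_cancel_left, hD]
    rw [inv_mul_cancel_left₀ hw0, Real.sqrt_sq (norm_nonneg _)]
  · refine (hs.mul_left ((w ω)⁻¹ * lam⁻¹)).congr fun t => ?_
    simp only [hU]
    field_simp

/-- Almost surely, the whole sequence of iterates converges to a (random) zero of `v`. -/
theorem ae_exists_tendsto_zero [IsFiniteMeasure P] (hlam : 0 < lam)
    (hv : ∀ x x', inner ℝ (x' - x) (v x' - v x) ≤ -lam * ‖v x' - v x‖ ^ 2)
    (hne : {z | v z = 0}.Nonempty) (hβ0 : ∀ t, 0 ≤ β t) (hβlam : ∀ t, β t ≤ lam)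
    (hβ : ¬ Summable β) (hβ2 : Summable fun t => β t ^ 2) (hx₀ : Measurable (x 0))
    (hx : ∀ t ω, x (t + 1) ω = x t ω + β t • (v (x t ω) + M (t + 1) ω))
    (hM : IsAffineMartingaleNoise P σ x M) :
    ∀ᵐ ω ∂P, ∃ p, v p = 0 ∧ Tendsto (fun t => x t ω) atTop (𝓝 p) := by
  -- The exceptional null set depends on the zero, so only countably many zeros may be used.
  obtain ⟨D, hDz, hDc, hDd⟩ :=
    (TopologicalSpace.IsSeparable.of_separableSpace {z | v z = 0}).exists_countable_dense_subset
  have hDne : D.Nonempty := closure_nonempty_iff.1 (hne.mono hDd)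
  have hae : ∀ᵐ ω ∂P, ∀ z ∈ D, (∃ c, Tendsto (fun t => ‖x t ω - z‖) atTop (𝓝 c)) ∧
      Summable fun t => β t * ‖v (x t ω)‖ ^ 2 :=
    (ae_ball_iff hDc).2 fun z hz =>
      ae_tendsto_norm_sub_and_summable hlam hv hβ0 hβlam hβ2 hx₀ hx hM (hDz hz)
  filter_upwards [hae] with ω hω
  obtain ⟨z₀, hz₀⟩ := hDne
  exact exists_tendsto_zero_of_dense (continuous_of_cocoercive hlam hv) hDd ⟨z₀, hz₀⟩ hβ0 hβ
    (fun z hz => (hω z hz).1) (hω z₀ hz₀).2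

end StochasticApproximation

theorem theorem1 {N d : ℕ} (G : ContinuousGame N d) (lam : ℝ) (hlam : 0 < lam)
    (hG : G.IsCocoercive lam) (hNE : G.nashSet.Nonempty)
    {Ω : Type*} [MeasurableSpace Ω] (P : Measure Ω) [IsProbabilityMeasure P]
    -- stepsizes
    (b T₀ : ℝ) (hb : 1 / 2 < b) (hb' : b < 1)
    (hT₀ : max 1 (max (lam ^ (-1 / b)) ((2 * b) ^ (1 / (1 - b)))) ≤ T₀)
    (β : ℕ → ℝ) (hβ : ∀ t : ℕ, β t = 1 / ((t : ℝ) + T₀) ^ b)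
    -- iterates, gradient feedback and noise
    (x vhat M : ℕ → Ω → Profile N d) (hx₀ : Measurable (x 0))
    (hx : ∀ t ω n, x (t + 1) ω n = x t ω n + β t • vhat t ω n)
    (hvhat : ∀ t ω n, vhat t ω n = G.v (x t ω) n + M (t + 1) ω n)
    (σ : ℝ) (hM : IsAffineMartingaleNoise P σ x M) :
    G.nashSet = {z | G.v z = 0} ∧
      ∀ᵐ ω ∂P, Tendsto (fun t => Metric.infDist (x t ω) G.nashSet) atTop (𝓝 0) := by
  have hnash := hG.nashSet_eq hlam.le
  refine ⟨hnash, ?_⟩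
  have hT1 : 1 ≤ T₀ := (le_max_left _ _).trans hT₀
  have hT0 : 0 ≤ T₀ := zero_le_one.trans hT1
  have hTlam : lam ^ (-1 / b) ≤ T₀ := ((le_max_left _ _).trans (le_max_right _ _)).trans hT₀
  have hβ0 : ∀ t, 0 ≤ β t := fun t => by rw [hβ]; positivity
  have hx' : ∀ t ω, x (t + 1) ω = x t ω + β t • (G.v (x t ω) + M (t + 1) ω) := fun t ω =>
    PiLp.ext fun n => by simp [hx, hvhat]
  filter_upwards [ae_exists_tendsto_zero hlam hG.inner_le (hnash ▸ hNE) hβ0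
    (stepsize_le hlam (by linarith) hTlam hβ) (not_summable_stepsize hb'.le hT0 hβ)
    (summable_stepsize_sq hb hT0 hβ) hx₀ hx' hM] with ω ⟨p, hp, hlim⟩
  have hpn : p ∈ G.nashSet := hnash ▸ hp
  have h := ((Metric.continuous_infDist_pt G.nashSet).tendsto p).comp hlim
  rwa [Metric.infDist_zero_of_mem hpn] at h
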